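/- Let $n \ge 0$ be an integer, let $S_{2n}$ be the symmetric group on $\{1,\dots,2n\}$, and let $B_n \subseteq S_{2n}$ be the hyperoctahedral group, i.e. the stabilizer (under conjugation) of the fixed-point-free involution $\sigma = (1\,2)(3\,4)\cdots(2n-1\;2n)$. For a partition $\lambda \vdash 2n$ let $S^\lambda$ denote the complex Specht module: the subrepresentation, of the permutation representation of $S_{2n}$ on formal $\mathbb{C}$-linear combinations of tabloids of shape $\lambda$, spanned by the polytabloids $e_t = \sum_{\pi \in C_t} \operatorname{sgn}(\pi)\,\{\pi t\}$, where $t$ runs over the tableaux of shape $\lambda$ (bijective fillings of its diagram by $1,\dots,2n$), $\{t\}$ is the row-equivalence class of $t$, and $C_t$ is the group of permutations preserving every column of $t$. Call $\lambda$ even if all of its parts are even. Then the decomposition into irreducibles of the complex representation of $S_{2n}$ induced from the trivial representation of $B_n$ is $$\operatorname{Ind}_{B_n}^{S_{2n}}(1) \;\cong\; \bigoplus_{\substack{\lambda \vdash 2n \\ \lambda \text{ even}}} S^\lambda .$$ That is, the two sides are isomorphic as complex representations of $S_{2n}$, every summand $S^\lambda$ on the right is irreducible, and the summands are pairwise non-isomorphic,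 so that the decomposition is multiplicity-free. -/

import Mathlib

open scoped MonoidAlgebra

namespace SpechtMatching

/-- The partner of `i` in the perfect matching `01 | 23 | 45 | ⋯` of `{0, …, 2n - 1}`. -/
def partner (n : ℕ) (i : Fin (2 * n)) : Fin (2 * n) :=
  if h : Even (i : ℕ) then
    ⟨i + 1, by obtain ⟨k, hk⟩ := h; have := i.isLt; omega⟩
  else ⟨i - 1, by have := i.isLt; omega⟩

theorem partner_involutive (n : ℕ) : Function.Involutive (partner n) := by
  intro i
  apply Fin.ext
  rcases Nat.even_or_odd (i : ℕ) with h | h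
  · have h' : ¬ Even ((i : ℕ) + 1) := by simpa [Nat.even_add_one] using h
    simp [partner, h, h']
  · have h' : ¬ Even (i : ℕ) := by simpa using h
    have h'' : Even ((i : ℕ) - 1) := by obtain ⟨k, hk⟩ := h; exact ⟨k, by omega⟩
    have : 1 ≤ (i : ℕ) := by obtain ⟨k, hk⟩ := h; omega
    simp [partner, h', h'', this]

/-- The permutation `(0 1)(2 3)⋯(2n-2 2n-1)`. -/
def matching (n : ℕ) : Equiv.Perm (Fin (2 * n)) :=
  (partner_involutive n).toPerm

/-- The hyperoctahedral group: the stabilizer of the permutation `(0 1)(2 3)⋯(2n-2 2n-1)` under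
conjugation. -/
def hyperoctahedral (n : ℕ) : Subgroup (Equiv.Perm (Fin (2 * n))) :=
  Subgroup.centralizer {matching n}

/-- The Young diagram of a partition; its rows are the parts in weakly decreasing order. -/
def diagram {N : ℕ} (l : N.Partition) : YoungDiagram :=
  YoungDiagram.ofRowLens (l.parts.sort (· ≥ ·)) (l.parts.pairwise_sort (· ≥ ·)).sortedGE

/-- A tableau of shape `l ⊢ N`: a bijective filling of the cells of the diagram with the numbers
`0, …, N - 1`. -/
def Tableau {N : ℕ} (l : N.Partition) : Type :=
  {c : ℕ × ℕ // c ∈ (diagram l).cells} ≃ Fin N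

section

variable {N : ℕ} {l : N.Partition}

/-- The row of a tableau that contains the entry `k`. -/
def Tableau.row (t : Tableau l) (k : Fin N) : ℕ := (Equiv.symm t k).1.1

/-- The column of a tableau that contains the entry `k`. -/
def Tableau.col (t : Tableau l) (k : Fin N) : ℕ := (Equiv.symm t k).1.2

/-- Permutations act on tableaux by acting on the entries. -/
instance : MulAction (Equiv.Perm (Fin N)) (Tableau l) where
  smul g t := Equiv.trans t g
  one_smul _ := rfl
  mul_smul _ _ _ := rfl

theorem Tableau.row_smul (g : Equiv.Perm (Fin N)) (t : Tableau l) (k : Fin N) :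
    (g • t).row k = t.row (g⁻¹ k) := rfl

theorem Tableau.col_smul (g : Equiv.Perm (Fin N)) (t : Tableau l) (k : Fin N) :
    (g • t).col k = t.col (g⁻¹ k) := rfl

/-- Two tableaux are row equivalent if every entry lies in the same row of both. -/
instance rowSetoid (l : N.Partition) : Setoid (Tableau l) :=
  Setoid.ker Tableau.row

variable (l) in
/-- A tabloid is a row equivalence class of tableaux. -/
def Tabloid : Type := Quotient (rowSetoid l)

/-- The tabloid of a tableau. -/
def Tableau.tabloid (t : Tableau l) : Tabloid l := Quotient.mk (rowSetoid l) t

theorem Tableau.tabloid_eq_iff {s t : Tableau l} : s.tabloid = t.tabloid ↔ s.row = t.row :=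
  Quotient.eq

instance : MulAction (Equiv.Perm (Fin N)) (Tabloid l) where
  smul g := Quotient.map (g • ·) fun s t (h : s.row = t.row) =>
    show (g • s).row = (g • t).row from
      funext fun k => by rw [Tableau.row_smul, Tableau.row_smul, h]
  one_smul x := Quotient.inductionOn x fun _ => rfl
  mul_smul _ _ x := Quotient.inductionOn x fun _ => rfl

theorem smul_tabloid (g : Equiv.Perm (Fin N)) (t : Tableau l) :
    g • t.tabloid = (g • t).tabloid := rfl

/-- The column stabilizer `C_t` of a tableau `t`: the permutations of the entries that preserve
every column of `t`. -/
def Tableau.columnStabilizer (t : Tableau l) : Subgroup (Equiv.Perm (Fin N)) where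
  carrier := {g | ∀ k, t.col (g k) = t.col k}
  one_mem' _ := rfl
  mul_mem' {g h} hg hh k := (hg (h k)).trans (hh k)
  inv_mem' {g} hg k := by simpa using (hg (g⁻¹ k)).symm

theorem Tableau.mem_columnStabilizer {t : Tableau l} {g : Equiv.Perm (Fin N)} :
    g ∈ t.columnStabilizer ↔ ∀ k, t.col (g k) = t.col k := Iff.rfl

instance (t : Tableau l) : DecidablePred (· ∈ t.columnStabilizer) :=
  fun g => inferInstanceAs (Decidable (∀ k, t.col (g k) = t.col k))

variable (l) in
/-- The permutation module `M^l` spanned by the tabloids of shape `l`. -/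
noncomputable def permutationModule :
    Representation ℂ (Equiv.Perm (Fin N)) ℂ[Tabloid l] :=
  Representation.ofMulAction ℂ (Equiv.Perm (Fin N)) (Tabloid l)

/-- The polytabloid `e_t = ∑_{π ∈ C_t} sgn(π) {π t}`. -/
noncomputable def Tableau.polytabloid (t : Tableau l) : ℂ[Tabloid l] :=
  ∑ g : Equiv.Perm (Fin N) with g ∈ t.columnStabilizer,
    MonoidAlgebra.single (g • t).tabloid (((Equiv.Perm.sign g : ℤˣ) : ℤ) : ℂ)

theorem permutationModule_polytabloid (g : Equiv.Perm (Fin N)) (t : Tableau l) :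
    permutationModule l g t.polytabloid = (g • t).polytabloid := by
  simp only [Tableau.polytabloid, map_sum, permutationModule, Representation.ofMulAction_single,
    smul_tabloid]
  refine Finset.sum_equiv (MulAut.conj g).toEquiv (fun h => ?_) (fun h _ => ?_)
  · simp only [Finset.mem_filter, Finset.mem_univ, true_and, Tableau.mem_columnStabilizer,
      Tableau.col_smul]
    constructor
    · intro H k
      simpa using H (g⁻¹ k)
    · intro H k
      simpa using H (g k)
  · have hs : Equiv.Perm.sign (g * h * g⁻¹) = Equiv.Perm.sign h := by
      rw [Equiv.Perm.sign_mul, Equiv.Perm.sign_mul, Equiv.Perm.sign_inv, mul_right_comm,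
        Int.units_mul_self, one_mul]
    change _ = MonoidAlgebra.single (((g * h * g⁻¹) • g • t).tabloid)
      (((Equiv.Perm.sign (g * h * g⁻¹) : ℤˣ) : ℤ) : ℂ)
    rw [hs, smul_smul, smul_smul, inv_mul_cancel_right]

variable (l) in
/-- The complex Specht module `S^l`: the subrepresentation of `M^l` spanned by the polytabloids. -/
noncomputable def spechtModule : Subrepresentation (permutationModule l) where
  toSubmodule := Submodule.span ℂ (Set.range (Tableau.polytabloid (l := l)))
  apply_mem_toSubmodule g v hv := by
    induction hv using Submodule.span_induction with
    | mem x hx =>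
      obtain ⟨t, rfl⟩ := hx
      rw [permutationModule_polytabloid]
      exact Submodule.subset_span ⟨_, rfl⟩
    | zero => simp
    | add x y _ _ hx hy => rw [map_add]; exact Submodule.add_mem _ hx hy
    | smul a x _ hx => rw [map_smul]; exact Submodule.smul_mem _ a hx

variable (l) in
/-- The Specht module as a representation of the symmetric group. -/
noncomputable def specht :
    Representation ℂ (Equiv.Perm (Fin N)) (spechtModule l).toSubmodule :=
  (spechtModule l).toRepresentation

end

/-- The partitions of `N` all of whose parts are even. -/
abbrev EvenPartition (N : ℕ) : Type := {l : N.Partition // ∀ i ∈ l.parts, Even i}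

/-- The representation of the symmetric group on `2n` letters that is induced from the trivial
one-dimensional complex representation of the hyperoctahedral group. -/
noncomputable def inducedTrivial (n : ℕ) :
    Representation ℂ (Equiv.Perm (Fin (2 * n)))
      (Representation.IndV (hyperoctahedral n).subtype
        (Representation.trivial ℂ (hyperoctahedral n) ℂ)) :=
  Representation.ind (hyperoctahedral n).subtype
    (Representation.trivial ℂ (hyperoctahedral n) ℂ)

end SpechtMatching

namespace SpechtMatching

open Finset

theorem card_cellsOfRowLens (w : List ℕ) : (YoungDiagram.cellsOfRowLens w).card = w.sum := by
  induction w with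
  | nil => simp [YoungDiagram.cellsOfRowLens]
  | cons a w ih =>
    rw [YoungDiagram.cellsOfRowLens, card_union_of_disjoint, card_map, ih]
    · simp
    · rw [disjoint_left]
      rintro ⟨i, j⟩ h₁ h₂
      simp only [mem_product, mem_singleton, mem_range, mem_map] at h₁ h₂
      obtain ⟨c, -, hc⟩ := h₂
      have := congrArg Prod.fst hc
      simp at this
      omega

section

variable {N : ℕ} {l m : N.Partition}

theorem card_cells_diagram (l : N.Partition) : (diagram l).cells.card = N := by
  have h : (l.parts.sort (· ≥ ·)).sum = N := by
    rw [← Multiset.sum_coe, Multiset.sort_eq, l.parts_sum]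
  exact (card_cellsOfRowLens _).trans h

instance (l : N.Partition) : Nonempty (Tableau l) :=
  ⟨Fintype.equivFinOfCardEq (by simp [card_cells_diagram])⟩

theorem rowLens_diagram (l : N.Partition) :
    (diagram l).rowLens = l.parts.sort (· ≥ ·) :=
  YoungDiagram.rowLens_ofRowLens_eq_self fun _ hx => l.parts_pos ((Multiset.mem_sort _).1 hx)

theorem diagram_injective : Function.Injective (diagram (N := N)) := by
  intro l m h
  have h' : l.parts.sort (· ≥ ·) = m.parts.sort (· ≥ ·) := by
    rw [← rowLens_diagram, ← rowLens_diagram, h]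
  apply Nat.Partition.ext
  rw [← Multiset.sort_eq l.parts (· ≥ ·), h', Multiset.sort_eq]

/-- The number of cells in the rows above row `i`. -/
def cellsAbove (d : YoungDiagram) (i : ℕ) : ℕ := (d.cells.filter fun c => c.1 < i).card

theorem cellsAbove_succ (d : YoungDiagram) (i : ℕ) :
    cellsAbove d (i + 1) = cellsAbove d i + d.rowLen i := by
  rw [YoungDiagram.rowLen_eq_card, cellsAbove, cellsAbove, YoungDiagram.row,
    ← card_union_of_disjoint]
  · congr 1
    ext c
    simp only [mem_filter, mem_union]
    rw [Nat.lt_succ_iff_lt_or_eq]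
    tauto
  · rw [disjoint_left]
    intro c h₁ h₂
    have := (mem_filter.1 h₁).2
    have := (mem_filter.1 h₂).2
    omega

theorem eq_of_cellsAbove_eq {d e : YoungDiagram} (h : ∀ i, cellsAbove d i = cellsAbove e i) :
    d = e := by
  have hr (i : ℕ) : d.rowLen i = e.rowLen i := by
    have h₁ := cellsAbove_succ d i
    have h₂ := cellsAbove_succ e i
    rw [h i, h (i + 1)] at h₁
    omega
  ext ⟨i, j⟩
  rw [YoungDiagram.mem_cells, YoungDiagram.mem_cells, YoungDiagram.mem_iff_lt_rowLen,
    YoungDiagram.mem_iff_lt_rowLen, hr]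

theorem Tableau.cell_mem (t : Tableau l) (a : Fin N) : (t.row a, t.col a) ∈ diagram l :=
  (Equiv.symm t a).2

theorem Tableau.row_apply (t : Tableau l) (c : {c : ℕ × ℕ // c ∈ (diagram l).cells}) :
    t.row (Equiv.toFun t c) = c.1.1 :=
  congrArg (fun x => x.1.1) (Equiv.symm_apply_apply t c)

theorem Tableau.col_apply (t : Tableau l) (c : {c : ℕ × ℕ // c ∈ (diagram l).cells}) :
    t.col (Equiv.toFun t c) = c.1.2 :=
  congrArg (fun x => x.1.2) (Equiv.symm_apply_apply t c)

theorem Tableau.card_filter (t : Tableau l) (p : ℕ × ℕ → Prop) [DecidablePred p] :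
    (univ.filter fun a => p (t.row a, t.col a)).card = ((diagram l).cells.filter p).card := by
  refine card_bij' (fun a _ => (t.row a, t.col a))
    (fun c hc => Equiv.toFun t ⟨c, (mem_filter.1 hc).1⟩) ?_ ?_ ?_ ?_
  · intro a ha
    exact mem_filter.2 ⟨t.cell_mem a, (mem_filter.1 ha).2⟩
  · intro c hc
    refine mem_filter.2 ⟨mem_univ _, ?_⟩
    rw [t.row_apply, t.col_apply]
    exact (mem_filter.1 hc).2
  · intro a ha
    exact Equiv.apply_symm_apply t a
  · intro c hc
    rw [t.row_apply, t.col_apply]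

theorem Tableau.card_col_eq (t : Tableau l) (j : ℕ) :
    (univ.filter fun a => t.col a = j).card = (diagram l).colLen j := by
  rw [YoungDiagram.colLen_eq_card]
  exact t.card_filter fun c => c.2 = j

/-- No two entries lie in the same row of `s` and in the same column of `t`. -/
def Separated (s : Tableau m) (t : Tableau l) : Prop :=
  ∀ a b, s.row a = s.row b → t.col a = t.col b → a = b

theorem card_cells_above_col (d : YoungDiagram) (i j : ℕ) :
    (d.cells.filter fun c => c.1 < i ∧ c.2 = j).card = min i (d.colLen j) := by
  have : (d.cells.filter fun c => c.1 < i ∧ c.2 = j) = range (min i (d.colLen j)) ×ˢ {j} := by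
    ext ⟨a, b⟩
    simp only [mem_filter, YoungDiagram.mem_cells, YoungDiagram.mem_iff_lt_colLen, mem_product,
      mem_range, lt_min_iff, mem_singleton]
    constructor
    · rintro ⟨h, h', rfl⟩
      exact ⟨⟨h', h⟩, rfl⟩
    · rintro ⟨⟨h, h'⟩, rfl⟩
      exact ⟨h', h, rfl⟩
  simp [this]

theorem Separated.card_le {s : Tableau m} {t : Tableau l} (h : Separated s t) (i j : ℕ) :
    (univ.filter fun a => s.row a < i ∧ t.col a = j).card ≤ min i ((diagram l).colLen j) := by
  refine le_min ?_ ?_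
  · rw [← card_range i]
    refine card_le_card_of_injOn s.row (fun a ha => ?_) fun a ha b hb hab => ?_
    · simpa using (mem_filter.1 ha).2.1
    · exact h a b hab ((mem_filter.1 ha).2.2.trans (mem_filter.1 hb).2.2.symm)
  · rw [← t.card_col_eq]
    exact card_le_card fun a ha => by
      simpa using (mem_filter.1 ha).2.2

theorem cellsAbove_eq_sum_card (s : Tableau m) (t : Tableau l) (i : ℕ) :
    cellsAbove (diagram m) i = ∑ j ∈ (diagram l).cells.image Prod.snd,
      (univ.filter fun a => s.row a < i ∧ t.col a = j).card := by
  rw [cellsAbove, ← s.card_filter fun c => c.1 < i,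
    card_eq_sum_card_fiberwise (f := t.col) (t := (diagram l).cells.image Prod.snd)]
  · simp only [filter_filter]
  · intro a _
    exact mem_coe.2 (mem_image.2 ⟨_, t.cell_mem a, rfl⟩)

theorem cellsAbove_eq_sum_min (d : YoungDiagram) (i : ℕ) :
    cellsAbove d i = ∑ j ∈ d.cells.image Prod.snd, min i (d.colLen j) := by
  rw [cellsAbove,
    card_eq_sum_card_fiberwise (f := Prod.snd) (t := d.cells.image Prod.snd)]
  · simp only [filter_filter, card_cells_above_col]
  · intro c hc
    exact mem_coe.2 (mem_image.2 ⟨_, (mem_filter.1 hc).1, rfl⟩)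

theorem Separated.cellsAbove_le {s : Tableau m} {t : Tableau l} (h : Separated s t) (i : ℕ) :
    cellsAbove (diagram m) i ≤ cellsAbove (diagram l) i := by
  rw [cellsAbove_eq_sum_card s t, cellsAbove_eq_sum_min]
  exact sum_le_sum fun j _ => h.card_le i j

theorem Separated.mem_diagram {s t : Tableau l} (h : Separated s t) (a : Fin N) :
    (s.row a, t.col a) ∈ diagram l := by
  have key (i : ℕ) : (univ.filter fun b => s.row b < i ∧ t.col b = t.col a).card =
      min i ((diagram l).colLen (t.col a)) := by
    refine (sum_eq_sum_iff_of_le fun j _ => h.card_le i j).1 ?_ _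
      (mem_image.2 ⟨_, t.cell_mem a, rfl⟩)
    rw [← cellsAbove_eq_sum_card s t, cellsAbove_eq_sum_min]
  have hlt : (univ.filter fun b => s.row b < s.row a ∧ t.col b = t.col a).card <
      (univ.filter fun b => s.row b < s.row a + 1 ∧ t.col b = t.col a).card := by
    refine card_lt_card ((ssubset_iff_of_subset fun b hb => ?_).2 ⟨a, ?_, ?_⟩)
    · simp only [mem_filter, mem_univ, true_and] at hb ⊢
      exact ⟨hb.1.trans (Nat.lt_succ_self _), hb.2⟩
    · simp
    · simp
  rw [key, key] at hlt
  rw [YoungDiagram.mem_iff_lt_colLen]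
  omega

theorem Tableau.ext_row_col (t : Tableau l) {a b : Fin N} (hr : t.row a = t.row b)
    (hc : t.col a = t.col b) : a = b :=
  (Equiv.symm t).injective (Subtype.ext (Prod.ext hr hc))

theorem Separated.exists_smul_tabloid_eq {s t : Tableau l} (h : Separated s t) :
    ∃ g ∈ t.columnStabilizer, (g • t).tabloid = s.tabloid := by
  let f : Fin N → {c : ℕ × ℕ // c ∈ (diagram l).cells} := fun a => ⟨_, h.mem_diagram a⟩
  have hf : Function.Bijective f := by
    rw [Fintype.bijective_iff_injective_and_card]
    refine ⟨fun a b hab => ?_, by simp [card_cells_diagram]⟩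
    exact h a b (congrArg (fun x => x.1.1) hab) (congrArg (fun x => x.1.2) hab)
  let e := Equiv.ofBijective f hf
  let g : Equiv.Perm (Fin N) := (Equiv.symm t).trans e.symm
  have hg (k : Fin N) : e (g k) = Equiv.symm t k := by simp [g]
  refine ⟨g, fun k => ?_, Tableau.tabloid_eq_iff.2 (funext fun k => ?_)⟩
  · exact congrArg (fun x => x.1.2) (hg k)
  · rw [Tableau.row_smul]
    have := congrArg (fun x => x.1.1) (hg (g⁻¹ k))
    rw [← Equiv.Perm.mul_apply, mul_inv_cancel, Equiv.Perm.one_apply] at this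
    exact this.symm

end

section

variable {N : ℕ} {l m : N.Partition}

/-- The sign of a permutation as a complex number. -/
noncomputable def csign (g : Equiv.Perm (Fin N)) : ℂ := ((Equiv.Perm.sign g : ℤˣ) : ℤ)

theorem csign_mul (g h : Equiv.Perm (Fin N)) : csign (g * h) = csign g * csign h := by
  simp [csign]

theorem csign_mul_self (g : Equiv.Perm (Fin N)) : csign g * csign g = 1 := by
  rcases Int.units_eq_one_or (Equiv.Perm.sign g) with h | h <;> simp [csign, h]

theorem csign_inv (g : Equiv.Perm (Fin N)) : csign g⁻¹ = csign g := by
  simp [csign]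

theorem conj_csign (g : Equiv.Perm (Fin N)) : (starRingEnd ℂ) (csign g) = csign g := by
  simp [csign]

variable {V W : Type*} [AddCommGroup V] [Module ℂ V] [AddCommGroup W] [Module ℂ W]

/-- The signed sum of the elements of the column stabilizer of `t`, acting on a representation. -/
noncomputable def Tableau.antisymmetrizer (t : Tableau l)
    (ρ : Representation ℂ (Equiv.Perm (Fin N)) V) : V →ₗ[ℂ] V :=
  ∑ g : Equiv.Perm (Fin N) with g ∈ t.columnStabilizer, csign g • ρ g

variable {ρ : Representation ℂ (Equiv.Perm (Fin N)) V}
  {σ : Representation ℂ (Equiv.Perm (Fin N)) W}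

theorem Tableau.antisymmetrizer_apply (t : Tableau l) (v : V) :
    t.antisymmetrizer ρ v =
      ∑ g : Equiv.Perm (Fin N) with g ∈ t.columnStabilizer, csign g • ρ g v := by
  simp [Tableau.antisymmetrizer]

theorem Tableau.antisymmetrizer_apply_apply (t : Tableau l) {h : Equiv.Perm (Fin N)}
    (hh : h ∈ t.columnStabilizer) (v : V) :
    t.antisymmetrizer ρ (ρ h v) = csign h • t.antisymmetrizer ρ v := by
  rw [antisymmetrizer_apply, antisymmetrizer_apply, smul_sum]
  refine sum_equiv (Equiv.mulRight h) (fun g => ?_) fun g _ => ?_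
  · simp only [mem_filter, mem_univ, true_and, Equiv.coe_mulRight]
    exact (Subgroup.mul_mem_cancel_right _ hh).symm
  · rw [Equiv.coe_mulRight, csign_mul, smul_smul, mul_comm (csign g), ← mul_assoc, csign_mul_self,
      one_mul, map_mul, Module.End.mul_apply]

theorem Tableau.map_antisymmetrizer (t : Tableau l) (f : ρ.IntertwiningMap σ) (v : V) :
    f (t.antisymmetrizer ρ v) = t.antisymmetrizer σ (f v) := by
  simp only [antisymmetrizer_apply, map_sum, map_smul, f.isIntertwining]

theorem Tableau.polytabloid_eq_sum (t : Tableau l) :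
    t.polytabloid = ∑ g : Equiv.Perm (Fin N) with g ∈ t.columnStabilizer,
      csign g • MonoidAlgebra.single (g • t.tabloid) (1 : ℂ) := by
  simp [Tableau.polytabloid, smul_tabloid, csign]

theorem permutationModule_single (g : Equiv.Perm (Fin N)) (x : Tabloid l) (c : ℂ) :
    permutationModule l g (.single x c) = .single (g • x) c :=
  Representation.ofMulAction_single ..

theorem Tableau.antisymmetrizer_single_tabloid (t : Tableau l) :
    t.antisymmetrizer (permutationModule l) (.single t.tabloid 1) = t.polytabloid := by
  simp only [antisymmetrizer_apply, polytabloid_eq_sum, permutationModule_single]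

theorem Tableau.antisymmetrizer_polytabloid (t : Tableau l) :
    t.antisymmetrizer (permutationModule l) t.polytabloid =
      ((univ.filter fun g : Equiv.Perm (Fin N) => g ∈ t.columnStabilizer).card : ℂ) •
        t.polytabloid := by
  conv_lhs => rw [polytabloid_eq_sum]
  rw [map_sum, sum_congr rfl (g := fun _ => t.polytabloid)]
  · rw [sum_const, Nat.cast_smul_eq_nsmul]
  · intro g hg
    rw [map_smul, ← permutationModule_single, t.antisymmetrizer_apply_apply (mem_filter.1 hg).2,
      smul_smul, csign_mul_self, one_smul, antisymmetrizer_single_tabloid]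

theorem Tableau.antisymmetrizer_single_eq_zero {t : Tableau l} {s : Tableau m}
    (h : ¬ Separated s t) :
    t.antisymmetrizer (permutationModule m) (.single s.tabloid 1) = 0 := by
  simp only [Separated, not_forall] at h
  obtain ⟨a, b, hr, hc, hab⟩ := h
  have hswap : Equiv.swap a b ∈ t.columnStabilizer := by
    intro k
    rw [Equiv.swap_apply_def]
    split_ifs with h₁ h₂
    · rw [h₁, hc]
    · rw [h₂, hc]
    · rfl
  have hfix : Equiv.swap a b • s.tabloid = s.tabloid := by
    rw [smul_tabloid, tabloid_eq_iff]
    funext k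
    rw [row_smul, Equiv.swap_inv, Equiv.swap_apply_def]
    split_ifs with h₁ h₂
    · rw [h₁, hr]
    · rw [h₂, hr]
    · rfl
  have := t.antisymmetrizer_apply_apply (ρ := permutationModule m) hswap (.single s.tabloid 1)
  rw [permutationModule_single, hfix, csign, Equiv.Perm.sign_swap hab] at this
  simp only [Units.val_neg, Units.val_one, Int.cast_neg, Int.cast_one, neg_smul, one_smul] at this
  have h2 := (two_smul ℂ _).trans (eq_neg_iff_add_eq_zero.1 this)
  exact (smul_eq_zero.1 h2).resolve_left two_ne_zero

theorem Tableau.antisymmetrizer_mem_span (t : Tableau l) (u : ℂ[Tabloid l]) :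
    t.antisymmetrizer (permutationModule l) u ∈ Submodule.span ℂ {t.polytabloid} := by
  induction u using MonoidAlgebra.induction_linear with
  | zero => simp
  | add x y hx hy => rw [map_add]; exact Submodule.add_mem _ hx hy
  | single x c =>
    obtain ⟨s, rfl⟩ : ∃ s : Tableau l, s.tabloid = x := Quotient.exists_rep x
    rw [← mul_one c, ← smul_eq_mul, ← MonoidAlgebra.smul_single, map_smul]
    refine Submodule.smul_mem _ _ ?_
    by_cases h : Separated s t
    · obtain ⟨g, hg, hgt⟩ := h.exists_smul_tabloid_eq
      rw [← hgt, ← smul_tabloid, ← permutationModule_single, t.antisymmetrizer_apply_apply hg,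
        antisymmetrizer_single_tabloid]
      exact Submodule.smul_mem _ _ (Submodule.mem_span_singleton_self _)
    · rw [antisymmetrizer_single_eq_zero h]
      exact Submodule.zero_mem _

theorem Tableau.coeff_antisymmetrizer (t : Tableau l) (u : ℂ[Tabloid l]) :
    (t.antisymmetrizer (permutationModule l) u).coeff t.tabloid =
      ∑ g : Equiv.Perm (Fin N) with g ∈ t.columnStabilizer,
        csign g * u.coeff (g • t.tabloid) := by
  rw [antisymmetrizer_apply, MonoidAlgebra.coeff_sum, Finsupp.finsetSum_apply]
  refine sum_equiv (Equiv.inv _) (fun g => ?_) fun g _ => ?_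
  · simp
  · rw [MonoidAlgebra.coeff_smul, Finsupp.smul_apply, permutationModule,
      Representation.coeff_ofMulAction, Equiv.inv_apply, csign_inv, smul_eq_mul]

theorem Tableau.polytabloid_ne_zero (t : Tableau l) : t.polytabloid ≠ 0 := by
  intro h
  have h' := t.coeff_antisymmetrizer (.single t.tabloid 1)
  rw [antisymmetrizer_single_tabloid, h, MonoidAlgebra.coeff_zero, Finsupp.zero_apply,
    sum_eq_single_of_mem 1] at h'
  · simp [csign] at h'
  · exact mem_filter.2 ⟨mem_univ _, Subgroup.one_mem _⟩
  · intro g hg hg1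
    rw [MonoidAlgebra.coeff_single, Finsupp.single_eq_of_ne, mul_zero]
    intro hgt
    apply hg1
    ext k : 1
    refine t.ext_row_col ?_ ((mem_filter.1 hg).2 k)
    have := congrFun (tabloid_eq_iff.1 hgt) (g k)
    rw [row_smul, ← Equiv.Perm.mul_apply, inv_mul_cancel, Equiv.Perm.one_apply] at this
    exact this.symm

theorem eq_zero_of_mem_spechtModule {u : ℂ[Tabloid l]} (hu : u ∈ (spechtModule l).toSubmodule)
    (h : ∀ t : Tableau l, t.antisymmetrizer (permutationModule l) u = 0) : u = 0 := by
  let L : ℂ[Tabloid l] →ₗ[ℂ] ℂ :=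
    Finsupp.linearCombination ℂ (fun x => (starRingEnd ℂ) (u.coeff x)) ∘ₗ
      (MonoidAlgebra.coeffLinearEquiv ℂ).toLinearMap
  have hL : (spechtModule l).toSubmodule ≤ LinearMap.ker L := by
    refine Submodule.span_le.2 ?_
    rintro _ ⟨t, rfl⟩
    have := congrArg (starRingEnd ℂ) (t.coeff_antisymmetrizer u)
    rw [h, map_sum] at this
    simp only [map_mul, conj_csign] at this
    rw [SetLike.mem_coe, LinearMap.mem_ker, Tableau.polytabloid_eq_sum, map_sum]
    simpa [L] using this.symm
  have h0 : L u = 0 := hL hu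
  have hsum : L u = ((∑ x ∈ u.coeff.support, Complex.normSq (u.coeff x) : ℝ) : ℂ) := by
    simp [L, Finsupp.linearCombination_apply, Finsupp.sum, Complex.mul_conj]
  rw [hsum, Complex.ofReal_eq_zero, sum_eq_zero_iff_of_nonneg fun _ _ => Complex.normSq_nonneg _]
    at h0
  apply MonoidAlgebra.coeff_injective
  ext x
  by_contra hx
  exact hx (by simpa using h0 x (Finsupp.mem_support_iff.2 hx))

theorem Tableau.polytabloid_mem (t : Tableau l) : t.polytabloid ∈ (spechtModule l).toSubmodule :=
  Submodule.subset_span ⟨t, rfl⟩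

/-- The polytabloid as an element of the Specht module. -/
noncomputable def Tableau.spechtVector (t : Tableau l) : (spechtModule l).toSubmodule :=
  ⟨t.polytabloid, t.polytabloid_mem⟩

theorem specht_spechtVector (g : Equiv.Perm (Fin N)) (t : Tableau l) :
    specht l g t.spechtVector = (g • t).spechtVector :=
  Subtype.ext (permutationModule_polytabloid g t)

theorem span_spechtVector : Submodule.span ℂ (Set.range (Tableau.spechtVector (l := l))) = ⊤ := by
  apply Submodule.map_injective_of_injective (spechtModule l).toSubmodule.injective_subtype
  rw [Submodule.map_span, Submodule.map_top, Submodule.range_subtype, ← Set.range_comp]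
  rfl

/-- The inclusion of the Specht module into the permutation module. -/
noncomputable def spechtInclusion (l : N.Partition) :
    (specht l).IntertwiningMap (permutationModule l) where
  toLinearMap := (spechtModule l).toSubmodule.subtype
  isIntertwining' _ := rfl

theorem subrepresentation_antisymmetrizer_mem (U : Subrepresentation ρ) (t : Tableau l) {v : V}
    (hv : v ∈ U.toSubmodule) : t.antisymmetrizer ρ v ∈ U.toSubmodule := by
  rw [t.antisymmetrizer_apply]
  exact Submodule.sum_mem _ fun g _ => Submodule.smul_mem _ _ (U.apply_mem_toSubmodule g hv)

theorem specht_isIrreducible (l : N.Partition) : (specht l).IsIrreducible := by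
  obtain ⟨t₀⟩ : Nonempty (Tableau l) := inferInstance
  refine { exists_pair_ne := ⟨⊥, ⊤, fun h => ?_⟩, eq_bot_or_eq_top := fun U => ?_ }
  · have : t₀.spechtVector ∈ (⊥ : Subrepresentation (specht l)).toSubmodule := by
      rw [h]; trivial
    exact t₀.polytabloid_ne_zero (congrArg Subtype.val ((Submodule.mem_bot ℂ).1 this))
  by_cases hU : ∃ u ∈ U.toSubmodule, ∃ t : Tableau l, t.antisymmetrizer (specht l) u ≠ 0
  · right
    obtain ⟨u, hu, t, ht⟩ := hU
    have hinc : (t.antisymmetrizer (specht l) u : ℂ[Tabloid l]) =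
        t.antisymmetrizer (permutationModule l) u := t.map_antisymmetrizer (spechtInclusion l) u
    obtain ⟨c, hc⟩ := Submodule.mem_span_singleton.1 (t.antisymmetrizer_mem_span u.1)
    have hc' : c • t.spechtVector = t.antisymmetrizer (specht l) u :=
      Subtype.ext (hc.trans hinc.symm)
    have hc0 : c ≠ 0 := by
      rintro rfl
      rw [zero_smul] at hc'
      exact ht hc'.symm
    have hmem : t.spechtVector ∈ U.toSubmodule := by
      rw [← inv_smul_smul₀ hc0 t.spechtVector, hc']
      exact Submodule.smul_mem _ _ (subrepresentation_antisymmetrizer_mem U t hu)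
    apply Subrepresentation.toSubmodule_injective
    change U.toSubmodule = ⊤
    rw [eq_top_iff, ← span_spechtVector, Submodule.span_le]
    rintro _ ⟨s, rfl⟩
    have : ((Equiv.symm t).trans s : Equiv.Perm (Fin N)) • t = s := by
      apply Equiv.ext
      intro c
      exact congrArg s.toFun (Equiv.symm_apply_apply t c)
    rw [← this, ← specht_spechtVector]
    exact U.apply_mem_toSubmodule _ hmem
  · left
    push Not at hU
    apply Subrepresentation.toSubmodule_injective
    change U.toSubmodule = ⊥
    rw [eq_bot_iff]
    intro u hu
    refine (Submodule.mem_bot ℂ).2 (Subtype.ext (eq_zero_of_mem_spechtModule u.2 fun t => ?_))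
    exact (t.map_antisymmetrizer (spechtInclusion l) u).symm.trans
      (by rw [hU u hu t, map_zero])

theorem exists_separated_of_intertwiningMap (f : (specht l).IntertwiningMap (specht m))
    (hf : Function.Injective f) (t : Tableau l) : ∃ s : Tableau m, Separated s t := by
  by_contra! hs
  have hzero (u : ℂ[Tabloid m]) : t.antisymmetrizer (permutationModule m) u = 0 := by
    induction u using MonoidAlgebra.induction_linear with
    | zero => simp
    | add x y hx hy => rw [map_add, hx, hy, add_zero]
    | single x c =>
      obtain ⟨s, rfl⟩ : ∃ s : Tableau m, s.tabloid = x := Quotient.exists_rep x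
      rw [← mul_one c, ← smul_eq_mul, ← MonoidAlgebra.smul_single, map_smul,
        Tableau.antisymmetrizer_single_eq_zero (hs s), smul_zero]
  have h₁ : t.antisymmetrizer (specht l) t.spechtVector =
      ((univ.filter fun g : Equiv.Perm (Fin N) => g ∈ t.columnStabilizer).card : ℂ) •
        t.spechtVector :=
    Subtype.ext ((t.map_antisymmetrizer (spechtInclusion l) t.spechtVector).trans
      t.antisymmetrizer_polytabloid)
  have h₂ : t.antisymmetrizer (specht m) (f t.spechtVector) = 0 :=
    Subtype.ext ((t.map_antisymmetrizer (spechtInclusion m) (f t.spechtVector)).trans (hzero _))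
  rw [← t.map_antisymmetrizer, h₁, ← map_zero f] at h₂
  rcases smul_eq_zero.1 (hf h₂) with h | h
  · rw [Nat.cast_eq_zero, card_eq_zero] at h
    have : (1 : Equiv.Perm (Fin N)) ∈ univ.filter fun g => g ∈ t.columnStabilizer :=
      mem_filter.2 ⟨mem_univ _, Subgroup.one_mem _⟩
    rw [h] at this
    simp at this
  · exact t.polytabloid_ne_zero (congrArg Subtype.val h)

theorem eq_of_specht_equiv (e : (specht l).Equiv (specht m)) : l = m := by
  obtain ⟨t⟩ : Nonempty (Tableau l) := inferInstance
  obtain ⟨t'⟩ : Nonempty (Tableau m) := inferInstance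
  obtain ⟨s, hs⟩ := exists_separated_of_intertwiningMap e.toIntertwiningMap
    (EquivLike.injective e) t
  obtain ⟨s', hs'⟩ := exists_separated_of_intertwiningMap e.symm.toIntertwiningMap
    (EquivLike.injective e.symm) t'
  exact diagram_injective
    (eq_of_cellsAbove_eq fun i => le_antisymm (hs'.cellsAbove_le i) (hs.cellsAbove_le i))

end

section

variable {α : Type*} {x y : Equiv.Perm α}

theorem not_sameCycle_mul (hx : x * x = 1) (hy : y * y = 1) (hx' : ∀ a, x a ≠ a)
    (hy' : ∀ a, y a ≠ a) (a : α) : ¬ (x * y).SameCycle a (x a) := by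
  rintro ⟨k, hk⟩
  have hxinv : x⁻¹ = x := inv_eq_of_mul_eq_one_left hx
  have hyinv : y⁻¹ = y := inv_eq_of_mul_eq_one_left hy
  have hconj : x * (x * y) * x⁻¹ = (x * y)⁻¹ := by
    rw [mul_inv_rev, hxinv, hyinv, ← mul_assoc, hx, one_mul]
  have hpow (j : ℤ) (b : α) : x (((x * y) ^ j) b) = ((x * y) ^ (-j)) (x b) := by
    have := congrArg (fun z => (z ^ j) (x b)) hconj
    simp only [conj_zpow, inv_zpow'] at this
    simpa using this
  obtain ⟨j, rfl | rfl⟩ := Int.even_or_odd' k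
  · apply hx' (((x * y) ^ j) a)
    rw [hpow, ← hk, ← Equiv.Perm.mul_apply, ← zpow_add]
    congr 2
    ring
  · apply hy' (((x * y) ^ j) a)
    have hyx (b : α) : y b = x ((x * y) b) := by
      rw [← Equiv.Perm.mul_apply, ← mul_assoc, hx, one_mul]
    have : y (((x * y) ^ j) a) = x (((x * y) ^ (j + 1)) a) := by
      rw [hyx, add_comm j 1, zpow_add, zpow_one]
      rfl
    rw [this, hpow, ← hk, ← Equiv.Perm.mul_apply, ← zpow_add]
    congr 2
    ring

/-- Two fixed-point-free involutions of a set of size `2 * n` are, up to relabelling, the swap of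
the two halves of `Fin n × Bool` and its twist by a permutation of `Fin n`. -/
theorem exists_equiv_prod_bool [Fintype α] {n : ℕ} (hα : Fintype.card α = 2 * n)
    (hx : x * x = 1) (hy : y * y = 1) (hx' : ∀ a, x a ≠ a) (hy' : ∀ a, y a ≠ a) :
    ∃ (e : Fin n × Bool ≃ α) (q : Equiv.Perm (Fin n)), ∀ d,
      x (e (d, false)) = e (d, true) ∧ y (e (d, false)) = e (q d, true) := by
  classical
  have hxx (a : α) : x (x a) = a := by rw [← Equiv.Perm.mul_apply, hx, Equiv.Perm.one_apply]
  let S := Equiv.Perm.SameCycle.setoid (x * y)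
  let ε := Fintype.equivFin α
  let f : α → Fin (Fintype.card α) := fun a => ε (Quotient.out (Quotient.mk S a))
  have hf {a b : α} : f a = f b ↔ (x * y).SameCycle a b := by
    constructor
    · intro h
      have := congrArg (Quotient.mk S) (ε.injective h)
      rw [Quotient.out_eq, Quotient.out_eq] at this
      exact Quotient.exact this
    · intro h
      have : Quotient.mk S a = Quotient.mk S b := Quotient.sound h
      simp only [f, this]
  have hne (a : α) : f a ≠ f (x a) := fun h => not_sameCycle_mul hx hy hx' hy' a (hf.1 h)
  have hfp (a : α) : f ((x * y) a) = f a := hf.2 (Equiv.Perm.sameCycle_apply_left.2 (.refl _ _))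
  have hfxp (a : α) : f (x ((x * y) a)) = f (x a) := by
    rw [← hfp (x ((x * y) a))]
    congr 1
    have hyy (a : α) : y (y a) = a := by rw [← Equiv.Perm.mul_apply, hy, Equiv.Perm.one_apply]
    simp [hxx, hyy]
  let D := {a : α // f a < f (x a)}
  let F : D × Bool → α := fun d => if d.2 then x d.1.1 else d.1.1
  have hF : Function.Bijective F := by
    constructor
    · rintro ⟨⟨a, ha⟩, b⟩ ⟨⟨a', ha'⟩, b'⟩ h
      cases b <;> cases b' <;> simp only [F, if_true, Bool.false_eq_true, if_false] at h
      · subst h; rfl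
      · subst h
        rw [hxx] at ha
        exact (lt_asymm ha ha').elim
      · subst h
        rw [hxx] at ha'
        exact (lt_asymm ha ha').elim
      · obtain rfl := x.injective h
        rfl
    · intro a
      rcases lt_or_gt_of_ne (hne a) with h | h
      · exact ⟨(⟨a, h⟩, false), rfl⟩
      · exact ⟨(⟨x a, by rwa [hxx]⟩, true), hxx a⟩
  have hD : Fintype.card D = n := by
    have := Fintype.card_of_bijective hF
    rw [Fintype.card_prod, Fintype.card_bool] at this
    omega
  let η : Fin n ≃ D := (Fintype.equivFinOfCardEq hD).symm
  let p : Equiv.Perm D := (x * y).subtypePerm fun a => by rw [hfp, hfxp]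
  refine ⟨(η.prodCongr (Equiv.refl Bool)).trans (Equiv.ofBijective F hF),
    (η.trans p).trans η.symm, fun d => ⟨?_, ?_⟩⟩
  · simp [F]
  · simp only [Equiv.trans_apply, Equiv.prodCongr_apply, Prod.map_apply, Equiv.refl_apply,
      Equiv.apply_symm_apply, Equiv.ofBijective_apply]
    exact (hxx _).symm

theorem apply_comm_of_halves {β γ : Type*} {x' : Equiv.Perm β} (hx : x * x = 1)
    (hx' : x' * x' = 1) {e : γ × Bool ≃ α} {q : Equiv.Perm γ}
    (he : ∀ d, x (e (d, false)) = e (q d, true)) (h : α → β)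
    (hh : ∀ d, h (x (e (d, false))) = x' (h (e (d, false)))) (a : α) : h (x a) = x' (h a) := by
  obtain ⟨⟨d, b⟩, rfl⟩ := e.surjective a
  cases b
  · exact hh d
  · obtain ⟨d, rfl⟩ := q.surjective d
    rw [← he, hh, ← Equiv.Perm.mul_apply, hx, ← Equiv.Perm.mul_apply x', hx']
    rfl

end

theorem matching_mul_self (n : ℕ) : matching n * matching n = 1 := by
  ext a : 1
  exact partner_involutive n a

theorem matching_apply_ne (n : ℕ) (a : Fin (2 * n)) : matching n a ≠ a := by
  intro h
  have h := congrArg Fin.val h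
  change (partner n a).1 = a.1 at h
  unfold partner at h
  split_ifs at h with he
  · simp at h
  · simp only at h
    apply he
    exact ⟨0, by omega⟩

theorem mem_hyperoctahedral_iff {n : ℕ} {g : Equiv.Perm (Fin (2 * n))} :
    g ∈ hyperoctahedral n ↔ ∀ a, g (matching n a) = matching n (g a) := by
  rw [hyperoctahedral, Subgroup.mem_centralizer_singleton_iff, Equiv.ext_iff]
  rfl

theorem exists_equiv_matching (n : ℕ) (g : Equiv.Perm (Fin (2 * n))) :
    ∃ (e : Fin n × Bool ≃ Fin (2 * n)) (q : Equiv.Perm (Fin n)), ∀ d,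
      matching n (e (d, false)) = e (d, true) ∧
        (g * matching n * g⁻¹) (e (d, false)) = e (q d, true) := by
  refine exists_equiv_prod_bool (Fintype.card_fin _) (matching_mul_self n) ?_ (matching_apply_ne n)
    fun a h => ?_
  · rw [conj_mul, matching_mul_self, mul_one, mul_inv_cancel]
  · apply matching_apply_ne n (g⁻¹ a)
    have := congrArg (fun b => g⁻¹ b) h
    simpa using this

/-- The double cosets of the hyperoctahedral group are separated by partitions of `n`. -/
theorem exists_double_coset_invariant (n : ℕ) :
    ∃ κ : Equiv.Perm (Fin (2 * n)) → n.Partition, ∀ g g', κ g = κ g' →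
      ∃ b ∈ hyperoctahedral n, ∃ b' ∈ hyperoctahedral n, g' = b * g * b' := by
  choose e q h using exists_equiv_matching n
  have hn : Fintype.card (Fin n) = n := Fintype.card_fin n
  refine ⟨fun g => hn ▸ (q g).partition, fun g g' hgg' => ?_⟩
  have hconj : IsConj (q g) (q g') := by
    rw [Equiv.Perm.partition_eq_of_isConj]
    simpa using hgg'
  obtain ⟨r, hr⟩ := isConj_iff.1 hconj
  have hr' (d : Fin n) : r (q g d) = q g' (r d) := by simp [← hr]
  have hmm := matching_mul_self n
  have hinv (g : Equiv.Perm (Fin (2 * n))) :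
      (g * matching n * g⁻¹) * (g * matching n * g⁻¹) = 1 := by
    rw [conj_mul, hmm, mul_one, mul_inv_cancel]
  let k : Equiv.Perm (Fin (2 * n)) :=
    (e g).symm.trans ((r.prodCongr (Equiv.refl Bool)).trans (e g'))
  have hk (d : Fin n) (b : Bool) : k (e g (d, b)) = e g' (r d, b) := by simp [k]
  have h₁ := apply_comm_of_halves (x' := matching n) hmm hmm (q := 1) (fun d => (h g d).1) k
    fun d => by rw [(h g d).1, hk, hk, (h g' _).1]
  have h₂ := apply_comm_of_halves (hinv g) (hinv g') (fun d => (h g d).2) k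
    fun d => by rw [(h g d).2, hk, hk, (h g' _).2, hr']
  refine ⟨k, mem_hyperoctahedral_iff.2 h₁, (k * g)⁻¹ * g', ?_, by group⟩
  rw [← inv_mem_iff, mem_hyperoctahedral_iff]
  intro a
  have h₃ := congrArg (fun b => g'⁻¹ b) (h₂ (g a))
  simpa using h₃

section

variable {n : ℕ}

noncomputable instance : Fintype (hyperoctahedral n) := Fintype.ofFinite _

/-- The coset vector `⟦g ⊗ 1⟧` of the induced representation. -/
noncomputable def cosetVector (n : ℕ) (g : Equiv.Perm (Fin (2 * n))) :
    Representation.IndV (hyperoctahedral n).subtype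
      (Representation.trivial ℂ (hyperoctahedral n) ℂ) :=
  Representation.IndV.mk _ _ g 1

theorem inducedTrivial_cosetVector (h g : Equiv.Perm (Fin (2 * n))) :
    inducedTrivial n h (cosetVector n g) = cosetVector n (g * h⁻¹) :=
  Representation.ind_mk ..

theorem cosetVector_mul {b : Equiv.Perm (Fin (2 * n))} (hb : b ∈ hyperoctahedral n)
    (g : Equiv.Perm (Fin (2 * n))) : cosetVector n (b * g) = cosetVector n g := by
  refine (Representation.Coinvariants.mk_eq_iff _).2 ?_
  refine Representation.Coinvariants.mem_ker_of_eq (⟨b, hb⟩ : hyperoctahedral n)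
    (TensorProduct.tmul ℂ (.single g 1) 1) _ ?_
  simp

theorem span_cosetVector : Submodule.span ℂ (Set.range (cosetVector n)) = ⊤ := by
  rw [← Submodule.ker_mkQ (Submodule.span ℂ (Set.range (cosetVector n))), LinearMap.ker_eq_top]
  refine Representation.IndV.hom_ext _ _ fun h => LinearMap.ext_ring ?_
  exact (Submodule.Quotient.mk_eq_zero _).2 (Submodule.subset_span ⟨h, rfl⟩)

instance : FiniteDimensional ℂ (Representation.IndV (hyperoctahedral n).subtype
    (Representation.trivial ℂ (hyperoctahedral n) ℂ)) :=
  ⟨⟨(Set.finite_range (cosetVector n)).toFinset, by simpa using span_cosetVector⟩⟩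

variable {V : Type*} [AddCommGroup V] [Module ℂ V]
  {τ : Representation ℂ (Equiv.Perm (Fin (2 * n))) V}

/-- The map out of the induced representation given by an invariant vector. -/
noncomputable def inducedLift (v : V) (hv : ∀ b ∈ hyperoctahedral n, τ b v = v) :
    (inducedTrivial n).IntertwiningMap τ where
  toLinearMap := Representation.Coinvariants.lift _
    (TensorProduct.lift <| (Finsupp.lift _ _ _ fun h =>
      LinearMap.toSpanSingleton ℂ V (τ h⁻¹ v)) ∘ₗ
      (MonoidAlgebra.coeffLinearEquiv ℂ).toLinearMap)
    fun g ↦ by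
      ext h
      simp [Representation.ofMulAction_single, hv _ (inv_mem g.2)]
  isIntertwining' g := by
    ext h
    simp [inducedTrivial]

theorem inducedLift_cosetVector_one (v : V) (hv : ∀ b ∈ hyperoctahedral n, τ b v = v) :
    inducedLift v hv (cosetVector n 1) = v := by
  change (inducedLift v hv).toLinearMap _ = v
  simp [inducedLift, cosetVector]

/-- The sum of the translates of a vector under the hyperoctahedral group. -/
noncomputable def hyperSum (τ : Representation ℂ (Equiv.Perm (Fin (2 * n))) V) : V →ₗ[ℂ] V :=
  ∑ b : hyperoctahedral n, τ b

theorem hyperSum_apply (v : V) : hyperSum τ v = ∑ b : hyperoctahedral n, τ b v := by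
  simp [hyperSum]

theorem apply_hyperSum {b : Equiv.Perm (Fin (2 * n))} (hb : b ∈ hyperoctahedral n) (v : V) :
    τ b (hyperSum τ v) = hyperSum τ v := by
  rw [hyperSum_apply, map_sum]
  refine Fintype.sum_equiv (Equiv.mulLeft (⟨b, hb⟩ : hyperoctahedral n)) _ _ fun c => ?_
  simp

theorem hyperSum_apply_apply {b : Equiv.Perm (Fin (2 * n))} (hb : b ∈ hyperoctahedral n) (v : V) :
    hyperSum τ (τ b v) = hyperSum τ v := by
  rw [hyperSum_apply, hyperSum_apply]
  refine Fintype.sum_equiv (Equiv.mulRight (⟨b, hb⟩ : hyperoctahedral n)) _ _ fun c => ?_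
  simp

theorem hyperSum_of_invariant {v : V} (hv : ∀ b ∈ hyperoctahedral n, τ b v = v) :
    hyperSum τ v = (Fintype.card (hyperoctahedral n) : ℂ) • v := by
  rw [hyperSum_apply, sum_congr rfl fun (b : hyperoctahedral n) _ => hv b.1 b.2, sum_const,
    Nat.cast_smul_eq_nsmul, card_univ]

theorem hyperSum_cosetVector_mul {b b' : Equiv.Perm (Fin (2 * n))} (hb : b ∈ hyperoctahedral n)
    (hb' : b' ∈ hyperoctahedral n) (g : Equiv.Perm (Fin (2 * n))) :
    hyperSum (inducedTrivial n) (cosetVector n (b * g * b')) =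
      hyperSum (inducedTrivial n) (cosetVector n g) := by
  rw [mul_assoc, cosetVector_mul hb, ← inv_inv b', ← inducedTrivial_cosetVector,
    hyperSum_apply_apply (inv_mem hb')]

theorem finrank_intertwiningMap_inducedTrivial_le (n : ℕ) :
    Module.finrank ℂ ((inducedTrivial n).IntertwiningMap (inducedTrivial n)) ≤
      Fintype.card n.Partition := by
  obtain ⟨κ, hκ⟩ := exists_double_coset_invariant n
  let w := fun g => hyperSum (inducedTrivial n) (cosetVector n g)
  have hw : Function.FactorsThrough w κ := by
    intro g g' h
    obtain ⟨b, hb, b', hb', rfl⟩ := hκ g g' h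
    exact (hyperSum_cosetVector_mul hb hb' g).symm
  let u := Function.extend κ w 0
  have hsum (v) : hyperSum (inducedTrivial n) v ∈ Submodule.span ℂ (Set.range u) := by
    have hv : v ∈ Submodule.span ℂ (Set.range (cosetVector n)) := by
      rw [span_cosetVector]; trivial
    induction hv using Submodule.span_induction with
    | mem x hx =>
      obtain ⟨g, rfl⟩ := hx
      exact Submodule.subset_span ⟨κ g, hw.extend_apply 0 g⟩
    | zero => simp
    | add x y _ _ hx hy => rw [map_add]; exact Submodule.add_mem _ hx hy
    | smul a x _ hx => rw [map_smul]; exact Submodule.smul_mem _ a hx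
  let ev : (inducedTrivial n).IntertwiningMap (inducedTrivial n) →ₗ[ℂ]
      Submodule.span ℂ (Set.range u) :=
    { toFun := fun f => ⟨f (cosetVector n 1), by
        have hinv : ∀ b ∈ hyperoctahedral n,
            inducedTrivial n b (f (cosetVector n 1)) = f (cosetVector n 1) := by
          intro b hb
          rw [← f.isIntertwining, inducedTrivial_cosetVector, one_mul, ← mul_one b⁻¹,
            cosetVector_mul (inv_mem hb)]
        have := hsum (f (cosetVector n 1))
        rw [hyperSum_of_invariant hinv] at this
        exact (Submodule.smul_mem_iff _ (Nat.cast_ne_zero.2 Fintype.card_ne_zero)).1 this⟩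
      map_add' := fun _ _ => rfl
      map_smul' := fun _ _ => rfl }
  have hev : Function.Injective ev := by
    intro f f' h
    have h1 : f (cosetVector n 1) = f' (cosetVector n 1) := congrArg Subtype.val h
    apply Representation.IntertwiningMap.ext
    refine LinearMap.ext_on_range span_cosetVector fun g => ?_
    have hg : cosetVector n g = inducedTrivial n g⁻¹ (cosetVector n 1) := by
      rw [inducedTrivial_cosetVector, one_mul, inv_inv]
    change f _ = f' _
    rw [hg, f.isIntertwining, f'.isIntertwining, h1]
  exact (LinearMap.finrank_le_finrank_of_injective hev).trans (finrank_range_le_card u)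

theorem card_partition_le_card_evenPartition (n : ℕ) :
    Fintype.card n.Partition ≤ Fintype.card (EvenPartition (2 * n)) := by
  refine Fintype.card_le_of_injective (fun l => ⟨
    { parts := l.parts.map (2 * ·)
      parts_pos := fun {i} hi => by
        obtain ⟨j, hj, rfl⟩ := Multiset.mem_map.1 hi
        have := l.parts_pos hj
        omega
      parts_sum := by rw [Multiset.sum_map_mul_left, Multiset.map_id', l.parts_sum] }, ?_⟩) ?_
  · intro i hi
    obtain ⟨j, _, rfl⟩ := Multiset.mem_map.1 hi
    exact even_two_mul j
  · intro l m h
    apply Nat.Partition.ext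
    refine Multiset.map_injective (f := (2 * ·)) (fun a b h => by simpa using h) ?_
    exact congrArg (fun x => x.1.parts) h

end

section

variable {N : ℕ} {l : N.Partition}

theorem even_rowLen_diagram (hl : ∀ i ∈ l.parts, Even i) (i : ℕ) :
    Even ((diagram l).rowLen i) := by
  by_cases hi : i < (diagram l).rowLens.length
  · apply hl
    have := List.getElem_mem hi
    rw [YoungDiagram.get_rowLens, rowLens_diagram, Multiset.mem_sort] at this
    exact this
  · have h0 : (diagram l).rowLen i = 0 := by
      by_contra h
      apply hi
      rw [YoungDiagram.length_rowLens, ← YoungDiagram.mem_iff_lt_colLen,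
        YoungDiagram.mem_iff_lt_rowLen]
      omega
    rw [h0]
    exact Even.zero

/-- The other column of the pair of columns `2k, 2k + 1` that contains column `j`. -/
def siblingColumn (j : ℕ) : ℕ := if Even j then j + 1 else j - 1

theorem even_siblingColumn (j : ℕ) : Even (siblingColumn j) ↔ ¬ Even j := by
  unfold siblingColumn
  split_ifs with h
  · simp [Nat.even_add_one, h]
  · rw [Nat.not_even_iff_odd] at h
    obtain ⟨k, rfl⟩ := h
    simp

theorem siblingColumn_siblingColumn (j : ℕ) : siblingColumn (siblingColumn j) = j := by
  have := even_siblingColumn j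
  by_cases h : Even j
  · rw [siblingColumn, if_neg (by tauto), siblingColumn, if_pos h, Nat.add_sub_cancel]
  · rw [siblingColumn, if_pos (by tauto), siblingColumn, if_neg h]
    rw [Nat.not_even_iff_odd] at h
    obtain ⟨k, rfl⟩ := h
    omega

theorem sibling_mem_diagram (hl : ∀ i ∈ l.parts, Even i) {c : ℕ × ℕ}
    (hc : c ∈ (diagram l).cells) : (c.1, siblingColumn c.2) ∈ (diagram l).cells := by
  obtain ⟨i, j⟩ := c
  rw [YoungDiagram.mem_cells, YoungDiagram.mem_iff_lt_rowLen] at hc ⊢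
  change siblingColumn j < (diagram l).rowLen i
  obtain ⟨r, hr⟩ := even_rowLen_diagram hl i
  unfold siblingColumn
  split_ifs with h
  · obtain ⟨k, hk⟩ := h
    omega
  · omega

theorem exists_tableau_matching {n : ℕ} {l : (2 * n).Partition} (hl : ∀ i ∈ l.parts, Even i) :
    ∃ t : Tableau l, ∀ a, t.row (matching n a) = t.row a ∧
      t.col (matching n a) = siblingColumn (t.col a) := by
  obtain ⟨t⟩ : Nonempty (Tableau l) := inferInstance
  let dom : Equiv.Perm {c : ℕ × ℕ // c ∈ (diagram l).cells} :=
    Function.Involutive.toPerm (fun c => ⟨_, sibling_mem_diagram hl c.2⟩) fun c =>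
      Subtype.ext (Prod.ext rfl (siblingColumn_siblingColumn _))
  have hdd : dom * dom = 1 :=
    Equiv.ext fun c => Subtype.ext (Prod.ext rfl (siblingColumn_siblingColumn _))
  have hd (c) : dom c ≠ c := by
    intro h
    have h₁ : siblingColumn c.1.2 = c.1.2 := congrArg (fun x => x.1.2) h
    have h₂ := even_siblingColumn c.1.2
    rw [h₁] at h₂
    tauto
  have hcard : Fintype.card {c : ℕ × ℕ // c ∈ (diagram l).cells} = 2 * n := by
    simp [card_cells_diagram]
  have hm := matching_mul_self n
  obtain ⟨e, q, he⟩ := exists_equiv_prod_bool hcard hdd hdd hd hd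
  obtain ⟨e', q', he'⟩ := exists_equiv_prod_bool (Fintype.card_fin _) hm hm
    (matching_apply_ne n) (matching_apply_ne n)
  have key := apply_comm_of_halves hm hdd (q := 1) (fun d => (he' d).1) (e'.symm.trans e)
    fun d => by
      rw [(he' d).1, Equiv.trans_apply, Equiv.symm_apply_apply, Equiv.trans_apply,
        Equiv.symm_apply_apply, (he d).1]
  exact ⟨(e.symm.trans e' : _ ≃ _), fun a =>
    ⟨congrArg (fun x => x.1.1) (key a), congrArg (fun x => x.1.2) (key a)⟩⟩

theorem sign_eq_one_of_commute {α : Type*} [Fintype α] [DecidableEq α] {g x : Equiv.Perm α}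
    (p : α → Prop) [DecidablePred p] (hg : ∀ a, p (g a) ↔ p a) (hx : ∀ a, p (x a) ↔ ¬ p a)
    (hxx : ∀ a, x (x a) = a) (hgx : ∀ a, g (x a) = x (g a)) : Equiv.Perm.sign g = 1 := by
  let h : Equiv.Perm α := Equiv.Perm.ofSubtype (g.subtypePerm hg)
  have h₁ {a : α} (ha : p a) : h a = g a :=
    Equiv.Perm.ofSubtype_apply_of_mem (g.subtypePerm hg) ha
  have h₂ {a : α} (ha : ¬ p a) : h a = a :=
    Equiv.Perm.ofSubtype_apply_of_not_mem (g.subtypePerm hg) ha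
  have key : g = h * (x * h * x) := by
    ext a : 1
    simp only [Equiv.Perm.mul_apply]
    by_cases ha : p a
    · rw [h₂ (a := x a) (by rw [hx]; tauto), hxx, h₁ ha]
    · rw [h₁ (a := x a) (by rw [hx]; tauto), hgx, hxx, h₂ (by rw [hg]; exact ha)]
  rw [key]
  simp only [Equiv.Perm.sign_mul]
  rw [mul_right_comm (Equiv.Perm.sign x), Int.units_mul_self, one_mul, Int.units_mul_self]

/-- The row of a tabloid that contains the entry `k`. -/
def Tabloid.row (x : Tabloid l) : Fin N → ℕ := Quotient.lift Tableau.row (fun _ _ h => h) x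

theorem Tabloid.row_smul (g : Equiv.Perm (Fin N)) (x : Tabloid l) (k : Fin N) :
    (g • x).row k = x.row (g⁻¹ k) := by
  induction x using Quotient.inductionOn
  rfl

end

section

variable {n : ℕ} {l : (2 * n).Partition}

/-- Every pair of the standard matching lies in one row of the tabloid. -/
def Tabloid.Compatible (x : Tabloid l) : Prop := ∀ a, x.row (matching n a) = x.row a

theorem Tabloid.compatible_smul {b : Equiv.Perm (Fin (2 * n))} (hb : b ∈ hyperoctahedral n)
    (x : Tabloid l) : (b • x).Compatible ↔ x.Compatible := by
  have hb' := mem_hyperoctahedral_iff.1 (inv_mem hb)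
  constructor
  · intro h a
    have := h (b a)
    rw [row_smul, row_smul, hb'] at this
    simpa using this
  · intro h a
    rw [row_smul, row_smul, hb', h]

open Classical in
/-- The functional that counts the compatible tabloids with their coefficients. -/
noncomputable def compatibleSum (l : (2 * n).Partition) : ℂ[Tabloid l] →ₗ[ℂ] ℂ :=
  Finsupp.linearCombination ℂ (fun x => if x.Compatible then (1 : ℂ) else 0) ∘ₗ
    (MonoidAlgebra.coeffLinearEquiv ℂ).toLinearMap

open Classical in
theorem compatibleSum_single (x : Tabloid l) (c : ℂ) :
    compatibleSum l (.single x c) = if x.Compatible then c else 0 := by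
  simp [compatibleSum]

theorem compatibleSum_apply {b : Equiv.Perm (Fin (2 * n))} (hb : b ∈ hyperoctahedral n)
    (u : ℂ[Tabloid l]) : compatibleSum l (permutationModule l b u) = compatibleSum l u := by
  classical
  induction u using MonoidAlgebra.induction_linear with
  | zero => simp
  | add x y hx hy => rw [map_add, map_add, map_add, hx, hy]
  | single x c =>
    rw [permutationModule_single, compatibleSum_single, compatibleSum_single]
    simp only [Tabloid.compatible_smul hb]

theorem compatibleSum_polytabloid_ne_zero {t : Tableau l}
    (ht : ∀ a, t.row (matching n a) = t.row a ∧ t.col (matching n a) = siblingColumn (t.col a)) :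
    compatibleSum l t.polytabloid ≠ 0 := by
  classical
  have hsign : ∀ g ∈ t.columnStabilizer, (g • t.tabloid).Compatible → csign g = 1 := by
    intro g hg hc
    have hcol (a) : t.col (g⁻¹ a) = t.col a := (inv_mem hg : g⁻¹ ∈ t.columnStabilizer) a
    have hcomm : g⁻¹ ∈ hyperoctahedral n := by
      rw [mem_hyperoctahedral_iff]
      intro a
      refine t.ext_row_col ?_ ?_
      · rw [(ht _).1]
        exact hc a
      · rw [hcol, (ht _).2, (ht _).2, hcol]
    have : Equiv.Perm.sign g = 1 :=
      sign_eq_one_of_commute (x := matching n) (fun a => Even (t.col a))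
        (fun a => by rw [hg a]) (fun a => by rw [(ht a).2, even_siblingColumn])
        (partner_involutive n) (mem_hyperoctahedral_iff.1 (inv_mem_iff.1 hcomm))
    simp [csign, this]
  have hsum : compatibleSum l t.polytabloid = ((univ.filter fun g : Equiv.Perm (Fin (2 * n)) =>
      g ∈ t.columnStabilizer ∧ (g • t.tabloid).Compatible).card : ℂ) := by
    rw [t.polytabloid_eq_sum, map_sum, ← filter_filter, card_filter, Nat.cast_sum]
    refine sum_congr rfl fun g hg => ?_
    rw [map_smul, compatibleSum_single]
    split_ifs with h
    · rw [hsign g (mem_filter.1 hg).2 h]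
      simp
    · simp
  rw [hsum, Nat.cast_ne_zero]
  refine card_ne_zero_of_mem (a := 1) (mem_filter.2 ⟨mem_univ _, Subgroup.one_mem _, ?_⟩)
  rw [one_smul]
  exact fun a => (ht a).1

theorem exists_intertwiningMap_specht_ne_zero (hl : ∀ i ∈ l.parts, Even i) :
    ∃ f : (inducedTrivial n).IntertwiningMap (specht l), f ≠ 0 := by
  obtain ⟨t, ht⟩ := exists_tableau_matching hl
  let v := hyperSum (specht l) t.spechtVector
  refine ⟨inducedLift v fun b hb => apply_hyperSum hb _, fun h => ?_⟩
  have hv : v = 0 := by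
    rw [← inducedLift_cosetVector_one (τ := specht l) v fun b hb => apply_hyperSum hb _, h]
    rfl
  have hF (u : (spechtModule l).toSubmodule) :
      compatibleSum l (hyperSum (specht l) u : (spechtModule l).toSubmodule) =
        Fintype.card (hyperoctahedral n) * compatibleSum l u := by
    rw [hyperSum_apply, Submodule.coe_sum, map_sum]
    refine (sum_congr rfl fun b _ => compatibleSum_apply b.2 u.1).trans ?_
    rw [sum_const, card_univ, nsmul_eq_mul]
  have := hF t.spechtVector
  change compatibleSum l (v : ℂ[Tabloid l]) = _ at this
  rw [hv, Submodule.coe_zero, map_zero] at this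
  exact mul_ne_zero (Nat.cast_ne_zero.2 Fintype.card_ne_zero)
    (compatibleSum_polytabloid_ne_zero ht) this.symm

end

section

variable {k G V : Type*} [Field k] [Group G] [AddCommGroup V] [Module k V]
  {ρ : Representation k G V} {ι : Type*} [Fintype ι] {W : ι → Type*}
  [∀ i, AddCommGroup (W i)] [∀ i, Module k (W i)] {σ : ∀ i, Representation k G (W i)}

theorem exists_section [Finite G] [NeZero (Nat.card G : k)] {U : Type*} [AddCommGroup U]
    [Module k U] {τ : Representation k G U} (f : ρ.IntertwiningMap τ)
    (hf : Function.Surjective f) : ∃ s : τ.IntertwiningMap ρ, ∀ u, f (s u) = u := by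
  obtain ⟨C, hC⟩ := exists_isCompl f.ker
  let r : C.toRepresentation.IntertwiningMap τ :=
    { toLinearMap := f.toLinearMap ∘ₗ C.toSubmodule.subtype
      isIntertwining' := fun g => LinearMap.ext fun v => f.isIntertwining _ _ g v.1 }
  have hr : Function.Bijective r := by
    constructor
    · refine (injective_iff_map_eq_zero r).2 fun c hc => ?_
      have : c.1 ∈ (f.ker ⊓ C : Subrepresentation ρ).toSubmodule := ⟨hc, c.2⟩
      rw [hC.inf_eq_bot] at this
      exact Subtype.ext ((Submodule.mem_bot k).1 this)
    · intro u
      obtain ⟨v, rfl⟩ := hf u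
      have : v ∈ (f.ker ⊔ C : Subrepresentation ρ).toSubmodule := by
        rw [hC.sup_eq_top]; trivial
      obtain ⟨a, ha, c, hc, rfl⟩ := Submodule.mem_sup.1 this
      refine ⟨⟨c, hc⟩, ?_⟩
      change f c = f (a + c)
      have ha : f a = 0 := ha
      rw [map_add, ha, zero_add]
  let e := r.ofBijective hr
  refine ⟨{ toLinearMap := C.toSubmodule.subtype ∘ₗ e.symm.toLinearMap
            isIntertwining' := fun g => LinearMap.ext fun u =>
              congrArg Subtype.val (e.symm.toIntertwiningMap.isIntertwining _ _ g u) }, fun u => ?_⟩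
  exact e.apply_symm_apply u

/-- A representation with nonzero maps to pairwise non-isomorphic irreducible representations,
and with no more endomorphisms than there are of these, is their direct sum. -/
theorem nonempty_equiv_directSum [Finite G] [NeZero (Nat.card G : k)] [FiniteDimensional k V]
    (hσ : ∀ i, (σ i).IsIrreducible) (hne : ∀ i j, Nonempty ((σ i).Equiv (σ j)) → i = j)
    (f : ∀ i, ρ.IntertwiningMap (σ i)) (hf : ∀ i, f i ≠ 0)
    (hrank : Module.finrank k (ρ.IntertwiningMap ρ) ≤ Fintype.card ι) :
    Nonempty (ρ.Equiv (Representation.directSum σ)) := by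
  classical
  have hsurj (i) : Function.Surjective (f i) :=
    (Representation.IsIrreducible.surjective_or_eq_zero (f i)).resolve_right (hf i)
  choose s hs using fun i => exists_section (f i) (hsurj i)
  have hs' {i j} (hij : i ≠ j) (w : W i) : f j (s i w) = 0 := by
    rcases Representation.IsIrreducible.bijective_or_eq_zero ((f j).comp (s i)) with h | h
    · exact (hij (hne i j ⟨((f j).comp (s i)).ofBijective h⟩)).elim
    · exact DFunLike.congr_fun h w
  let F : ρ.IntertwiningMap (Representation.directSum σ) :=
    { toLinearMap := ∑ i, DirectSum.lof k ι W i ∘ₗ (f i).toLinearMap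
      isIntertwining' := fun g => by
        ext v i
        simp [DirectSum.lmap_lof, Representation.IntertwiningMap.isIntertwining] }
  have hF (v : V) (i : ι) : F v i = f i v := by
    change (∑ i, DirectSum.lof k ι W i ∘ₗ (f i).toLinearMap) v i = _
    rw [LinearMap.sum_apply, DirectSum.sum_apply, Finset.sum_eq_single i]
    · exact DirectSum.lof_apply k i _
    · intro j _ hj
      exact DirectSum.of_eq_of_ne _ _ _ hj.symm
    · simp
  refine ⟨F.ofBijective ⟨(injective_iff_map_eq_zero F).2 fun v hv => ?_, fun w => ?_⟩⟩
  · by_contra hv0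
    have hfv (i) : f i v = 0 := by rw [← hF, hv]; rfl
    have hW (i) : ∃ w : W i, w ≠ 0 := by
      by_contra! h
      exact hf i (DFunLike.ext _ _ fun v => h _)
    choose w hw using hW
    let p : Option ι → ρ.IntertwiningMap ρ := fun o =>
      o.elim (1 - ∑ i, (s i).comp (f i)) fun i => (s i).comp (f i)
    have hlin : LinearIndependent k p := by
      rw [Fintype.linearIndependent_iff]
      intro c hc
      have happ (x : V) : c none • (x - ∑ i, s i (f i x)) + ∑ i, c (some i) • s i (f i x) = 0 := by
        have := DFunLike.congr_fun hc x
        simpa [Fintype.sum_option, p, Representation.IntertwiningMap.sum_apply] using this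
      have hnone : c none = 0 := by
        have := happ v
        simp only [hfv, map_zero, smul_zero, Finset.sum_const_zero, sub_zero, add_zero] at this
        exact (smul_eq_zero.1 this).resolve_right hv0
      rintro (_ | j)
      · exact hnone
      · have := happ (s j (w j))
        rw [hnone, zero_smul, zero_add, Finset.sum_eq_single j, hs] at this
        · refine (smul_eq_zero.1 this).resolve_right fun h => hw j ?_
          rw [← hs j (w j), h, map_zero]
        · intro i _ hij
          rw [hs' hij.symm, map_zero, smul_zero]
        · simp
    have := hlin.fintype_card_le_finrank
    rw [Fintype.card_option] at this
    omega
  · refine ⟨∑ i, s i (w i), DFinsupp.ext fun j => ?_⟩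
    change F _ j = _
    rw [hF, map_sum, Finset.sum_eq_single j, hs]
    · intro i _ hij
      exact hs' hij _
    · simp

end

end SpechtMatching

theorem theorem1 (n : ℕ) :
    Nonempty ((SpechtMatching.inducedTrivial n).Equiv
      (Representation.directSum fun l : SpechtMatching.EvenPartition (2 * n) =>
        SpechtMatching.specht l.1)) ∧
    (∀ l : SpechtMatching.EvenPartition (2 * n), (SpechtMatching.specht l.1).IsIrreducible) ∧
    (∀ l m : SpechtMatching.EvenPartition (2 * n),
      Nonempty ((SpechtMatching.specht l.1).Equiv (SpechtMatching.specht m.1)) → l = m) := by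
  have hirr (l : SpechtMatching.EvenPartition (2 * n)) :
      (SpechtMatching.specht l.1).IsIrreducible :=
    SpechtMatching.specht_isIrreducible l.1
  have hne (l m : SpechtMatching.EvenPartition (2 * n))
      (h : Nonempty ((SpechtMatching.specht l.1).Equiv (SpechtMatching.specht m.1))) : l = m :=
    h.elim fun e => Subtype.ext (SpechtMatching.eq_of_specht_equiv e)
  refine ⟨?_, hirr, hne⟩
  choose f hf using fun l : SpechtMatching.EvenPartition (2 * n) =>
    SpechtMatching.exists_intertwiningMap_specht_ne_zero l.2
  exact SpechtMatching.nonempty_equiv_directSum hirr hne f hf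
    ((SpechtMatching.finrank_intertwiningMap_inducedTrivial_le n).trans
      (SpechtMatching.card_partition_le_card_evenPartition n))
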